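/- Let $n\ge 1$ and let $k_1,\dots,k_n,l_2,\dots,l_n$ be positive integers with $k_i>1$ for all $i$. Let $G=G(k_1,\dots,k_n,l_2,\dots,l_n)$ be the Artin group whose underlying labelled graph has vertices $u,u_1,\dots,u_n$, an edge $u - u_i$ with label $2k_i$ for each $1\le i\le n$, an edge $u_1 - u_i$ with label $2l_i+1$ for each $2\le i\le n$, and no other edges; that is, $G$ is generated by $u,u_1,\dots,u_n$ subject to the relations $(uu_i)^{k_i}=(u_iu)^{k_i}$ for $1\le i\le n$ and $(u_1u_i)^{l_i}u_1=(u_iu_1)^{l_i}u_i$ for $2\le i\le n$. Let $\chi:G\to\mathbb{R}$ be the homomorphism to the additive group $\mathbb{R}$ with $\chi(u)=1$ and $\chi(u_1)=-1$ (so that $\chi(u_i)=-1$ for all $i$). Suppose that $$\sum_{\substack{2\le i\le n\\ k_i\text{ is a power of }2}}\frac{1}{2l_i+1}<1 .$$ Let $S(G)$ be the set of classes $[\mu]=\mathbb{R}_{>0}\,\mu$ of nonzero homomorphisms $\mu:G\to\mathbb{R}$, and let $\Sigma^1(G)\subseteq S(G)$ be the set of those $[\mu]$ for which the trivial module $\mathbb{Z}$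 has type $FP_1$ over the monoid ring $\mathbb{Z}[G_\mu]$, where $G_\mu=\{g\in G\mid \mu(g)\ge 0\}$; that is, $\mathbb{Z}$ has a resolution by projective left $\mathbb{Z}[G_\mu]$-modules which are finitely generated in degrees $0$ and $1$. Then $[\chi]\in\Sigma^1(G)^c=S(G)\setminus\Sigma^1(G)$, and $\ker\chi$ is not finitely generated. -/

import Mathlib

open scoped MonoidAlgebra

/-! ### Finiteness properties of modules -/

/-- The left `R`-module `A` has type `FP_m`: it has a projective resolution
`⋯ → P 2 → P 1 → P 0 → A → 0` in which `P i` is finitely generated for every `i ≤ m`. -/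
def HasTypeFP.{u, v} (R : Type u) [Ring R] (A : Type v) [AddCommGroup A] [Module R A]
    (m : ℕ) : Prop :=
  ∃ (P : ℕ → Type (max u v)) (_ : ∀ i, AddCommGroup (P i)) (_ : ∀ i, Module R (P i))
    (d : ∀ i, P (i + 1) →ₗ[R] P i) (ε : P 0 →ₗ[R] A),
    (∀ i, Module.Projective R (P i)) ∧ (∀ i ≤ m, Module.Finite R (P i)) ∧
    Function.Surjective ε ∧ Function.Exact (d 0) ε ∧
    ∀ i, Function.Exact (d (i + 1)) (d i)

/-! ### Characters and the invariants `Σ^m(G, ℤ)` -/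

section Sigma

variable (G : Type*) [Group G]

/-- Real characters of `G`, that is, homomorphisms from `G` to the additive group `ℝ`. -/
abbrev RealCharacter : Type _ := Additive G →+ ℝ

/-- The character sphere `S(G)`: nonzero real characters up to positive real multiples. -/
abbrev CharacterSphere : Type _ := Module.Ray ℝ (RealCharacter G)

variable {G}

/-- The submonoid `G_χ = {g | χ(g) ≥ 0}` of `G`. -/
def nonnegSubmonoid (χ : RealCharacter G) : Submonoid G where
  carrier := {g | 0 ≤ χ (Additive.ofMul g)}
  one_mem' := by simp
  mul_mem' {a b} ha hb := by
    simp only [Set.mem_ofPred_eq, ofMul_mul, map_add] at *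
    exact add_nonneg ha hb

variable (G) in
/-- The invariant `Σ^m(G, ℤ)`: the classes `[χ]` such that the trivial module `ℤ` has type `FP_m`
over the monoid ring `ℤ[G_χ]`. -/
def sigmaInvariant (m : ℕ) : Set (CharacterSphere G) :=
  {s | ∃ (χ : RealCharacter G) (hχ : χ ≠ 0), rayOfNeZero ℝ χ hχ = s ∧
    HasTypeFP ℤ[nonnegSubmonoid χ]
      (Representation.trivial ℤ (nonnegSubmonoid χ) ℤ).asModule m}

variable (G) in
/-- The invariant `Σ^1(G) = Σ^1(G, ℤ)` of a finitely generated group. -/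
def sigmaOne : Set (CharacterSphere G) := sigmaInvariant G 1

/-- `G_χ` depends only on the class `[χ]`. -/
theorem nonnegSubmonoid_eq_of_ray_eq {χ ψ : RealCharacter G} (hχ : χ ≠ 0) (hψ : ψ ≠ 0)
    (h : rayOfNeZero ℝ χ hχ = rayOfNeZero ℝ ψ hψ) : nonnegSubmonoid χ = nonnegSubmonoid ψ := by
  obtain ⟨a, b, ha, hb, hab⟩ := ((ray_eq_iff hχ hψ).1 h).exists_pos hχ hψ
  ext g
  have hg : a * χ (Additive.ofMul g) = b * ψ (Additive.ofMul g) := DFunLike.congr_fun hab _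
  change 0 ≤ χ (Additive.ofMul g) ↔ 0 ≤ ψ (Additive.ofMul g)
  rw [← mul_nonneg_iff_of_pos_left ha, hg, mul_nonneg_iff_of_pos_left hb]

/-- Membership in `Σ^m(G, ℤ)` can be tested on any representative of the class. -/
theorem rayOfNeZero_mem_sigmaInvariant {χ : RealCharacter G} (hχ : χ ≠ 0) (m : ℕ) :
    rayOfNeZero ℝ χ hχ ∈ sigmaInvariant G m ↔
      HasTypeFP ℤ[nonnegSubmonoid χ]
        (Representation.trivial ℤ (nonnegSubmonoid χ) ℤ).asModule m := by
  constructor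
  · rintro ⟨ψ, hψ, h, hFP⟩
    rw [nonnegSubmonoid_eq_of_ray_eq hψ hχ h] at hFP
    exact hFP
  · exact fun h => ⟨χ, hχ, rfl, h⟩

theorem RealCharacter.ne_zero_of_eq_one {χ : RealCharacter G} {g : G}
    (h : χ (Additive.ofMul g) = 1) : χ ≠ 0 := by
  rintro rfl
  simp at h

end Sigma

/-! ### Artin groups -/

/-- The alternating product `a * b * a * ⋯` with `m` factors. -/
def alternatingProd {M : Type*} [Monoid M] (a b : M) : ℕ → M
  | 0 => 1
  | m + 1 => a * alternatingProd b a m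

/-- The relators `(uvu⋯)(vuv⋯)⁻¹`, each factor of length the label of the edge `uv`. -/
def artinRelators {V : Type*} (Γ : SimpleGraph V) (label : Sym2 V → ℕ) : Set (FreeGroup V) :=
  {r | ∃ u v : V, Γ.Adj u v ∧
    r = alternatingProd (FreeGroup.of u) (FreeGroup.of v) (label s(u, v)) *
      (alternatingProd (FreeGroup.of v) (FreeGroup.of u) (label s(u, v)))⁻¹}

/-- The Artin group of the graph `Γ` with edge labels `label` (values of `label` outside the edge
set play no role). -/
abbrev ArtinGroup {V : Type*} (Γ : SimpleGraph V) (label : Sym2 V → ℕ) : Type _ :=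
  PresentedGroup (artinRelators Γ label)

/-! ### The groups `G(k_1, …, k_n, l_2, …, l_n)`

The vertex `u` is `0 : Fin (n + 1)`, and the vertex `u_i` is `i : Fin (n + 1)` for `1 ≤ i ≤ n`. -/

/-- The graph with edges `u — u_i` for `1 ≤ i ≤ n` and `u_1 — u_i` for `2 ≤ i ≤ n`. -/
def fanGraph (n : ℕ) : SimpleGraph (Fin (n + 1)) :=
  SimpleGraph.fromRel fun a _ => a = 0 ∨ a = 1

/-- The edge `u — u_i` has label `2 k_i`, and the edge `u_1 — u_i` has label `2 l_i + 1`. -/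
def fanLabel (n : ℕ) (k l : ℕ → ℕ) (e : Sym2 (Fin (n + 1))) : ℕ :=
  if e.inf = 0 then 2 * k (e.sup : Fin (n + 1)) else 2 * l (e.sup : Fin (n + 1)) + 1

/-- The Artin group `G(k_1, …, k_n, l_2, …, l_n)`. -/
abbrev FanArtinGroup (n : ℕ) (k l : ℕ → ℕ) : Type :=
  ArtinGroup (fanGraph n) (fanLabel n k l)

/-- The generator of `G(k_1, …, k_n, l_2, …, l_n)` given by a vertex: `fanVertex n k l 0` is `u`,
and `fanVertex n k l i` is `u_i` for `1 ≤ i ≤ n`. -/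
def fanVertex (n : ℕ) (k l : ℕ → ℕ) (i : Fin (n + 1)) : FanArtinGroup n k l :=
  PresentedGroup.of i

/-!
Write `G` for the Artin group, `K = ker χ` and `a_i = u u_i ∈ K`. The group `G` maps onto the Coxeter
group with generators `u, u_1, …, u_n` in which `u u_i` has order dividing `k_i` (half of the label
`2 k_i`) and `u_1 u_i` has order dividing `2 l_i + 1`. On the geometric representation `V` of that
Coxeter group, extended to `V[T, T⁻¹]`, let `u` act as `T` times its reflection and each `u_i` as
`T⁻¹` times its reflection. The odd relations survive, since both sides carry the same power of `T`;
in `(u u_i)^{k_i} = (u_i u)^{k_i}` the powers of `T` cancel and both sides act trivially.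

The point is that this module carries a cocycle `δ` with `δ(u_i) = 0` and `δ(u)` the simple root
`e_u`: the relations between the `u_i` hold trivially, and the one between `u` and `u_i` asks for
`(1 + a_i + ⋯ + a_i^{k_i - 1}) e_u = 0`, which is true because `k_i > 1` and `a_i` acts as a nontrivial
rotation on the plane spanned by the two roots. Here the cocycle is built into a linear
representation (`fanRep`) on `V[T, T⁻¹] ⊕ ℝ[T, T⁻¹]`, with `δ(g) = g z - z` for the last basis vector
`z`: adding `z`-dependence to the coroot at `u` turns `u u_i` into a product of two honest reflections
again (`fanGen_zero_mul`), so that `reflection_mul_reflection_pow_eq_one` gives all the relations.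

An element `g` raises the order in `T` by exactly `χ(g)` (`fanRep_mem_iff`). Hence the vectors of
order at least `r` form a subgroup stable under `G_χ`, and these subgroups exhaust `V[T, T⁻¹]` as `r`
decreases. If `ℤ` has type `FP_1` over `ℤ[G_χ]`, then the augmentation ideal is finitely generated
and `δ(G_χ)` lies in a single one of them (`HasTypeFP.exists_forall_sub_mem`); if `K` is finitely
generated, the same holds for `δ(K)` (`Subgroup.FG.exists_forall_sub_mem`). But
`δ(u_1^j (u u_1) u_1^{-j}) = u_1^j e_u` has order `-j` (`not_exists_fanRep_sub_mem`), and these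
elements all lie in `K`.
-/

/-! ### Finiteness and filtrations -/

/-- If the trivial module `ℤ` is of type `FP_1` over `ℤ[S]`, the augmentation ideal is finitely
generated, so a principal cocycle `g ↦ g z - z` that takes values in a directed union of
`S`-invariant subgroups takes values in one of them. -/
theorem HasTypeFP.exists_forall_sub_mem {S : Type} [Monoid S]
    (h : HasTypeFP ℤ[S] (Representation.trivial ℤ S ℤ).asModule 1)
    {M : Type*} [AddCommGroup M] (ψ : S →* AddMonoid.End M) (z : M)
    {ι : Type*} [Nonempty ι] (N : ι → AddSubgroup M) (hdir : Directed (· ≤ ·) N)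
    (hN : ∀ g i, ∀ w ∈ N i, ψ g w ∈ N i) (hz : ∀ g, ∃ i, ψ g z - z ∈ N i) :
    ∃ i, ∀ g, ψ g z - z ∈ N i := by
  classical
  let A := (Representation.trivial ℤ S ℤ).asModule
  -- The module `ℤ` is finitely presented, so the kernel of `ℤ[S] → ℤ` is finitely generated.
  have hfp : Module.FinitePresentation ℤ[S] A := by
    obtain ⟨P, _, _, d, ε, hproj, hfin, hε, hd, -⟩ := h
    have := hproj 0
    have := hfin 0 zero_le_one
    have := hfin 1 le_rfl
    have := Module.finitePresentation_of_projective ℤ[S] (P 0)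
    refine Module.finitePresentation_of_surjective ε hε ?_
    rw [LinearMap.exact_iff.1 hd]
    exact Submodule.fg_range _
  let e : A ≃ₗ[ℤ] ℤ := (Representation.trivial ℤ S ℤ).asModuleEquiv
  let aug : ℤ[S] →ₗ[ℤ[S]] A := LinearMap.toSpanSingleton ℤ[S] A (e.symm 1)
  have aug_single (g : S) (c : ℤ) : aug (MonoidAlgebra.single g c) = e.symm c := by
    apply e.injective
    change e (MonoidAlgebra.single g c • e.symm 1) = _
    rw [e.apply_symm_apply]
    change (Representation.trivial ℤ S ℤ).asModuleEquiv _ = _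
    rw [Representation.asModuleEquiv_map_smul, Representation.asAlgebraHom_single]
    change c • e (e.symm 1) = c
    rw [e.apply_symm_apply, smul_eq_mul, mul_one]
  have aug_surj : Function.Surjective aug := fun a =>
    ⟨MonoidAlgebra.single 1 (e a), by rw [aug_single, e.symm_apply_apply]⟩
  obtain ⟨Y, hY⟩ := Module.FinitePresentation.fg_ker aug aug_surj
  let F : ℤ[S] →ₐ[ℤ] AddMonoid.End M := MonoidAlgebra.lift ℤ (AddMonoid.End M) S ψ
  have F_single (g : S) (c : ℤ) (w : M) : F (MonoidAlgebra.single g c) w = c • ψ g w := by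
    simp only [F, MonoidAlgebra.lift_single]
    rfl
  have hF (i : ι) (r : ℤ[S]) (w : M) (hw : w ∈ N i) : F r w ∈ N i := by
    induction r using MonoidAlgebra.induction_linear with
    | zero => rw [map_zero]; exact zero_mem _
    | add x y hx hy => rw [map_add]; exact add_mem hx hy
    | single g c => rw [F_single]; exact zsmul_mem (hN g i w hw) c
  have hFaug (r : ℤ[S]) : F r z - e (aug r) • z ∈ ⨆ i, N i := by
    induction r using MonoidAlgebra.induction_linear with
    | zero => simp
    | add x y hx hy =>
      have : F (x + y) z - e (aug (x + y)) • z
          = (F x z - e (aug x) • z) + (F y z - e (aug y) • z) := by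
        rw [map_add, map_add, map_add, add_smul]
        change F x z + F y z - _ = _
        abel
      rw [this]
      exact add_mem hx hy
    | single g c =>
      rw [F_single, aug_single, e.apply_symm_apply, ← smul_sub]
      obtain ⟨i, hi⟩ := hz g
      exact zsmul_mem (AddSubgroup.mem_iSup_of_mem i hi) c
  have hY' (y : ℤ[S]) (hy : y ∈ Y) : ∃ i, F y z ∈ N i := by
    have h0 : aug y = 0 := LinearMap.mem_ker.1 (hY ▸ Submodule.subset_span hy)
    have := hFaug y
    rw [h0, map_zero, zero_smul, sub_zero] at this
    exact (AddSubgroup.mem_iSup_of_directed hdir).1 this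
  choose! f hf using hY'
  obtain ⟨i, hi⟩ := hdir.finset_le (Y.image f)
  refine ⟨i, fun g => ?_⟩
  have key (w : ℤ[S]) (hw : w ∈ Submodule.span ℤ[S] (Y : Set ℤ[S])) : F w z ∈ N i := by
    induction hw using Submodule.span_induction with
    | mem y hy => exact hi (f y) (Finset.mem_image_of_mem f hy) (hf y hy)
    | zero => rw [map_zero]; exact zero_mem _
    | add x y _ _ hx hy => rw [map_add]; exact add_mem hx hy
    | smul r x _ hx => rw [smul_eq_mul, map_mul]; exact hF i r _ hx
  have := key (MonoidAlgebra.single g 1 - MonoidAlgebra.single 1 1) (by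
    rw [hY, LinearMap.mem_ker, map_sub, aug_single, aug_single, sub_self])
  rw [map_sub] at this
  change F _ z - F _ z ∈ N i at this
  simpa [F_single] using this

/-- The analogue of `HasTypeFP.exists_forall_sub_mem` for a finitely generated subgroup. -/
theorem Subgroup.FG.exists_forall_sub_mem {G : Type*} [Group G] {K : Subgroup G} (h : K.FG)
    {M : Type*} [AddCommGroup M] (ψ : G →* AddMonoid.End M) (z : M)
    {ι : Type*} [Nonempty ι] (N : ι → AddSubgroup M) (hdir : Directed (· ≤ ·) N)
    (hN : ∀ g ∈ K, ∀ i, ∀ w ∈ N i, ψ g w ∈ N i) (hz : ∀ g ∈ K, ∃ i, ψ g z - z ∈ N i) :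
    ∃ i, ∀ g ∈ K, ψ g z - z ∈ N i := by
  classical
  obtain ⟨Y, rfl⟩ := h
  choose! f hf using fun y (hy : y ∈ Y) => hz y (Subgroup.subset_closure hy)
  obtain ⟨i, hi⟩ := hdir.finset_le (Y.image f)
  refine ⟨i, fun g hg => ?_⟩
  induction hg using Subgroup.closure_induction with
  | mem y hy => exact hi (f y) (Finset.mem_image_of_mem f hy) (hf y hy)
  | one => simp
  | mul g g' hg _ h h' =>
    have : ψ (g * g') z - z = ψ g (ψ g' z - z) + (ψ g z - z) := by
      rw [map_mul, AddMonoid.End.coe_mul, Function.comp_apply, map_sub]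
      abel
    rw [this]
    exact add_mem (hN g hg i _ h') h
  | inv g hg h =>
    have : ψ g⁻¹ z - z = - ψ g⁻¹ (ψ g z - z) := by
      rw [map_sub, ← Function.comp_apply (f := ψ g⁻¹), ← AddMonoid.End.coe_mul, ← map_mul,
        inv_mul_cancel, map_one, neg_sub, AddMonoid.End.coe_one, id]
    rw [this]
    exact neg_mem (hN _ (inv_mem hg) i _ h)

/-! ### Products of two reflections -/

/-- If the root of each of two reflections pairs with the coroot of the other to `-2 cos (π / m)`,
the product of the reflections is a rotation by `2 π / m`. -/
theorem reflection_mul_reflection_pow_eq_one {Λ M : Type*} [CommRing Λ] [Algebra ℝ Λ]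
    [AddCommGroup M] [Module Λ M] {x y : M} {f g : Module.Dual Λ M} (hf : f x = 2) (hg : g y = 2)
    {m : ℕ} (hm : 2 ≤ m) (hfy : f y = algebraMap ℝ Λ (-2 * Real.cos (Real.pi / m)))
    (hgx : g x = algebraMap ℝ Λ (-2 * Real.cos (Real.pi / m))) :
    (Module.reflection hf * Module.reflection hg) ^ m = 1 := by
  rcases hm.eq_or_lt with rfl | hm
  · -- For `m = 2` the two reflections commute.
    have h0 : Real.cos (Real.pi / (2 : ℕ)) = 0 := by simp
    rw [h0, mul_zero, map_zero] at hfy hgx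
    ext w
    simp only [pow_two, LinearEquiv.mul_apply, Module.reflection_apply, map_sub, map_smul, hf, hg,
      hfy, hgx, LinearEquiv.coe_one, id]
    module
  · -- For `m > 2` the Chebyshev values are `s j = sin ((j + 1) θ) / sin θ` with `θ = 2 π / m`, and
    -- both coefficients of `reflection_mul_reflection_pow_apply` contain a vanishing factor.
    set θ : ℝ := 2 * Real.pi / m with hθ
    have hm0 : (m : ℝ) ≠ 0 := by positivity
    have hm2 : (2 : ℝ) < m := by exact_mod_cast hm
    have hsin : Real.sin θ ≠ 0 := by
      refine (Real.sin_pos_of_pos_of_lt_pi (by positivity) ?_).ne'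
      rw [hθ, div_lt_iff₀ (by positivity)]
      nlinarith [Real.pi_pos]
    have ht : algebraMap ℝ Λ (2 * Real.cos θ) = f y * g x - 2 := by
      have : 2 * Real.cos θ =
          (-2 * Real.cos (Real.pi / m)) * (-2 * Real.cos (Real.pi / m)) - 2 := by
        rw [show θ = 2 * (Real.pi / m) by rw [hθ]; ring, Real.cos_two_mul]
        ring
      rw [this, hfy, hgx, map_sub, map_mul, map_ofNat]
    ext w
    rw [Module.reflection_mul_reflection_pow_apply hf hg m w _ ht]
    simp only [← Polynomial.Chebyshev.algebraMap_eval_S, ← map_add, ← map_mul]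
    set s : ℤ → ℝ := fun j => (Polynomial.Chebyshev.S ℝ j).eval (2 * Real.cos θ) with hs
    have hsj (j : ℤ) : s j * Real.sin θ = Real.sin ((j + 1) * θ) :=
      Polynomial.Chebyshev.S_two_mul_real_cos θ j
    rcases Nat.even_or_odd' m with ⟨q, hq | hq⟩
    · have h1 : ((m : ℤ) - 1) / 2 = q - 1 := by omega
      have h2 : ((m : ℤ) - 2) / 2 = q - 1 := by omega
      have hq0 : s (q - 1) = 0 := by
        have := hsj (q - 1)
        have h' : (((q : ℤ) - 1 : ℤ) + 1 : ℝ) * θ = Real.pi := by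
          have : (m : ℝ) = 2 * q := by exact_mod_cast hq
          rw [hθ]
          push_cast
          field_simp
          linarith
        rw [h', Real.sin_pi] at this
        exact (mul_eq_zero.1 this).resolve_right hsin
      change w + algebraMap ℝ Λ (s (((m : ℤ) - 2) / 2) * _) • _
        + algebraMap ℝ Λ (s (((m : ℤ) - 1) / 2) * _) • _ = _
      rw [h1, h2, hq0]
      simp
    · have h1 : ((m : ℤ) - 1) / 2 = q := by omega
      have h2 : ((m : ℤ) - 2) / 2 = q - 1 := by omega
      have h3 : ((m : ℤ) - 3) / 2 = q - 1 := by omega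
      have h4 : (m : ℤ) / 2 = q := by omega
      have hq0 : s q + s (q - 1) = 0 := by
        have h' : (s q + s (q - 1)) * Real.sin θ = 0 := by
          rw [add_mul, hsj, hsj]
          have : ((q : ℤ) + 1 : ℝ) * θ = 2 * Real.pi - (((q : ℤ) - 1 : ℤ) + 1 : ℝ) * θ := by
            have : (m : ℝ) = 2 * q + 1 := by exact_mod_cast hq
            rw [hθ]
            push_cast
            field_simp
            linarith
          rw [this, Real.sin_two_pi_sub]
          ring
        exact (mul_eq_zero.1 h').resolve_right hsin
      change w + algebraMap ℝ Λ (s (((m : ℤ) - 2) / 2) *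
          (s (((m : ℤ) - 1) / 2) + s (((m : ℤ) - 3) / 2))) • _
        + algebraMap ℝ Λ (s (((m : ℤ) - 1) / 2) *
          (s ((m : ℤ) / 2) + s (((m : ℤ) - 2) / 2))) • _ = _
      rw [h1, h2, h3, h4, hq0]
      simp

/-! ### Alternating products -/

theorem map_alternatingProd {M N : Type*} [Monoid M] [Monoid N] (φ : M →* N) (a b : M) (m : ℕ) :
    φ (alternatingProd a b m) = alternatingProd (φ a) (φ b) m := by
  induction m generalizing a b with
  | zero => exact map_one φ
  | succ m ih => simp [alternatingProd, ih]

theorem alternatingProd_two_mul {M : Type*} [Monoid M] (a b : M) (m : ℕ) :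
    alternatingProd a b (2 * m) = (a * b) ^ m := by
  induction m with
  | zero => simp [alternatingProd]
  | succ m ih =>
    rw [pow_succ', ← ih, mul_assoc]
    rfl

theorem alternatingProd_two_mul_add_one {M : Type*} [Monoid M] (a b : M) (m : ℕ) :
    alternatingProd a b (2 * m + 1) = (a * b) ^ m * a := by
  rw [alternatingProd, alternatingProd_two_mul, mul_pow_mul]

/-- Involutions whose product has order dividing `2 m + 1` satisfy the braid relation of length
`2 m + 1`. -/
theorem mul_pow_mul_eq_of_involutive {G : Type*} [Group G] {a b : G} (ha : a * a = 1)
    (hb : b * b = 1) {m : ℕ} (h : (a * b) ^ (2 * m + 1) = 1) :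
    (a * b) ^ m * a = (b * a) ^ m * b := by
  have hinv : ((b * a) ^ m * b)⁻¹ = b * (a * b) ^ m := by
    rw [mul_inv_rev, ← inv_pow, mul_inv_rev, inv_eq_of_mul_eq_one_right ha,
      inv_eq_of_mul_eq_one_right hb]
  rw [← mul_inv_eq_one, hinv]
  calc (a * b) ^ m * a * (b * (a * b) ^ m) = (a * b) ^ (m + 1 + m) := by
        rw [pow_add, pow_succ]; simp only [mul_assoc]
    _ = 1 := by rw [← h]; congr 1; ring

section Fan

open scoped LaurentPolynomial

variable {n : ℕ} {k l : ℕ → ℕ}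

/-! ### A reflection representation over Laurent polynomials -/

/-- The label of an edge in the Coxeter quotient: `k_i` (half of `2 k_i`) on `u — u_i`, and
`2 l_i + 1` on `u_1 — u_i`. -/
def fanCoxeterLabel (n : ℕ) (k l : ℕ → ℕ) (e : Sym2 (Fin (n + 1))) : ℕ :=
  if e.inf = 0 then k (e.sup : Fin (n + 1)) else 2 * l (e.sup : Fin (n + 1)) + 1

/-- The Cartan matrix of the Coxeter quotient. The entries at non-adjacent vertices are arbitrary,
since no relation of the Artin group involves them. -/
noncomputable def fanCartan (n : ℕ) (k l : ℕ → ℕ) (s t : Fin (n + 1)) : ℝ :=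
  if s = t then 2 else -2 * Real.cos (Real.pi / fanCoxeterLabel n k l s(s, t))

/-- The direct sum of the geometric representation, with scalars extended to Laurent polynomials,
and of one further coordinate. -/
abbrev FanModule (n : ℕ) : Type := (Fin (n + 1) → ℝ[T;T⁻¹]) × ℝ[T;T⁻¹]

/-- The simple root at the vertex `s`. -/
noncomputable def fanRoot (n : ℕ) (s : Fin (n + 1)) : FanModule n := (Pi.single s 1, 0)

/-- The coroot at the vertex `s`; the coroot at `u` is shifted by the last coordinate, so that the
reflection at `u` acts as an affine reflection. -/
noncomputable def fanCoroot (n : ℕ) (k l : ℕ → ℕ) (s : Fin (n + 1)) :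
    Module.Dual ℝ[T;T⁻¹] (FanModule n) :=
  (∑ t, algebraMap ℝ ℝ[T;T⁻¹] (fanCartan n k l s t) • LinearMap.proj t) ∘ₗ LinearMap.fst _ _ _ -
    if s = 0 then LinearMap.snd _ _ _ else 0

theorem fanCoroot_apply (s : Fin (n + 1)) (w : FanModule n) :
    fanCoroot n k l s w = ∑ t, algebraMap ℝ ℝ[T;T⁻¹] (fanCartan n k l s t) * w.1 t -
      if s = 0 then w.2 else 0 := by
  unfold fanCoroot
  split_ifs <;> simp

theorem fanCoroot_fanRoot (s t : Fin (n + 1)) :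
    fanCoroot n k l s (fanRoot n t) = algebraMap ℝ ℝ[T;T⁻¹] (fanCartan n k l s t) := by
  simp [fanCoroot_apply, fanRoot, Pi.single_apply]

theorem fanCoroot_fanRoot_self (s : Fin (n + 1)) : fanCoroot n k l s (fanRoot n s) = 2 := by
  rw [fanCoroot_fanRoot, fanCartan, if_pos rfl, map_ofNat]

variable (k l) in
/-- The reflection at the vertex `s`. -/
noncomputable def fanReflection (s : Fin (n + 1)) : FanModule n ≃ₗ[ℝ[T;T⁻¹]] FanModule n :=
  Module.reflection (fanCoroot_fanRoot_self (k := k) (l := l) s)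

theorem fanReflection_apply (s : Fin (n + 1)) (w : FanModule n) :
    fanReflection k l s w = w - fanCoroot n k l s w • fanRoot n s :=
  Module.reflection_apply _ _

theorem fanReflection_mul_self (s : Fin (n + 1)) :
    fanReflection k l s * fanReflection k l s = 1 := by
  rw [mul_eq_one_iff_eq_inv, fanReflection, Module.reflection_inv]

theorem fanReflection_mul_pow {s t : Fin (n + 1)} (hst : s ≠ t)
    (h : 2 ≤ fanCoxeterLabel n k l s(s, t)) :
    (fanReflection k l s * fanReflection k l t) ^ fanCoxeterLabel n k l s(s, t) = 1 := by
  refine reflection_mul_reflection_pow_eq_one _ _ h ?_ ?_ <;>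
    rw [fanCoroot_fanRoot, fanCartan]
  · rw [if_neg hst]
  · rw [if_neg hst.symm, Sym2.eq_swap]

variable (n) in
/-- Multiplication by `T` on the geometric representation, the identity on the last coordinate. -/
noncomputable def fanShift : FanModule n ≃ₗ[ℝ[T;T⁻¹]] FanModule n :=
  (LinearEquiv.smulOfUnit (LaurentPolynomial.isUnit_T 1).unit).prodCongr (LinearEquiv.refl _ _)

theorem fanShift_apply (w : FanModule n) :
    fanShift n w = ((LaurentPolynomial.T 1 : ℝ[T;T⁻¹]) • w.1, w.2) := rfl

theorem commute_fanShift_fanReflection {s : Fin (n + 1)} (hs : s ≠ 0) :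
    Commute (fanShift n) (fanReflection k l s) := by
  refine LinearEquiv.ext fun w => ?_
  rw [LinearEquiv.mul_apply, LinearEquiv.mul_apply, fanReflection_apply, fanReflection_apply,
    fanShift_apply, fanShift_apply]
  have h : fanCoroot n k l s ((LaurentPolynomial.T 1 : ℝ[T;T⁻¹]) • w.1, w.2)
      = LaurentPolynomial.T 1 * fanCoroot n k l s w := by
    rw [fanCoroot_apply, fanCoroot_apply, if_neg hs, sub_zero, sub_zero, Finset.mul_sum]
    refine Finset.sum_congr rfl fun t _ => ?_
    change _ * (LaurentPolynomial.T 1 * w.1 t) = _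
    rw [mul_left_comm]
  rw [h]
  ext1
  · change LaurentPolynomial.T 1 • (w.1 - fanCoroot n k l s w • (fanRoot n s).1) =
      LaurentPolynomial.T 1 • w.1 - (LaurentPolynomial.T 1 * fanCoroot n k l s w) • (fanRoot n s).1
    rw [smul_sub, smul_smul]
  · simp [fanRoot]

variable (k l) in
/-- The image of the generator at the vertex `s`: it scales by `T` at `u` and by `T⁻¹` at `u_i`, so
that the exponent of `T` records `χ`. -/
noncomputable def fanGen (s : Fin (n + 1)) : FanModule n ≃ₗ[ℝ[T;T⁻¹]] FanModule n :=
  if s = 0 then fanReflection k l 0 * fanShift n else (fanShift n)⁻¹ * fanReflection k l s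

theorem fanGen_zero : fanGen k l (0 : Fin (n + 1)) = fanReflection k l 0 * fanShift n := if_pos rfl

theorem fanGen_of_ne_zero {s : Fin (n + 1)} (hs : s ≠ 0) :
    fanGen k l s = (fanShift n)⁻¹ * fanReflection k l s := if_neg hs

theorem fanGen_zero_mul {s : Fin (n + 1)} (hs : s ≠ 0) :
    fanGen k l 0 * fanGen k l s = fanReflection k l 0 * fanReflection k l s := by
  rw [fanGen_zero, fanGen_of_ne_zero hs]
  group

theorem alternatingProd_fanGen_zero {s : Fin (n + 1)} (hs : s ≠ 0) (hk : 1 < k s) :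
    alternatingProd (fanGen k l 0) (fanGen k l s) (2 * k s) =
      alternatingProd (fanGen k l s) (fanGen k l 0) (2 * k s) := by
  have hlab : fanCoxeterLabel n k l s(0, s) = k s := by
    simp [fanCoxeterLabel]
  have h : (fanGen k l 0 * fanGen k l s) ^ k s = 1 := by
    rw [fanGen_zero_mul hs, ← hlab]
    exact fanReflection_mul_pow hs.symm (by rw [hlab]; exact hk)
  rw [alternatingProd_two_mul, alternatingProd_two_mul, h]
  -- `u_i u` is conjugate to `u u_i`.
  rw [show fanGen k l s * fanGen k l 0 =
    (fanGen k l 0)⁻¹ * (fanGen k l 0 * fanGen k l s) * ((fanGen k l 0)⁻¹)⁻¹ by group, conj_pow, h]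
  group

theorem alternatingProd_fanGen {s t : Fin (n + 1)} (hs : s ≠ 0) (hst : s < t)
    (hl : 0 < l t) :
    alternatingProd (fanGen k l s) (fanGen k l t) (2 * l t + 1) =
      alternatingProd (fanGen k l t) (fanGen k l s) (2 * l t + 1) := by
  have ht : t ≠ 0 := (hs.bot_lt.trans hst).ne'
  have hlab : fanCoxeterLabel n k l s(s, t) = 2 * l t + 1 := by
    simp [fanCoxeterLabel, hst.le, hs]
  have hpow : (fanReflection k l s * fanReflection k l t) ^ (2 * l t + 1) = 1 := by
    rw [← hlab]
    exact fanReflection_mul_pow hst.ne (by omega)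
  have hcs := (commute_fanShift_fanReflection (k := k) (l := l) hs).inv_left
  have hct := (commute_fanShift_fanReflection (k := k) (l := l) ht).inv_left
  -- The shift commutes with both reflections, so it factors out of both sides.
  have key {a b h : FanModule n ≃ₗ[ℝ[T;T⁻¹]] FanModule n} (ha : Commute h a) (hb : Commute h b)
      (m : ℕ) : (h * a * (h * b)) ^ m * (h * a) = (h * h) ^ m * h * ((a * b) ^ m * a) := by
    have h1 : h * a * (h * b) = h * h * (a * b) := by
      rw [mul_assoc, ← mul_assoc a, ← ha.eq]; simp only [mul_assoc]
    have h2 : Commute h ((a * b) ^ m) := (ha.mul_right hb).pow_right m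
    have h3 : Commute (h * h) (a * b) :=
      Commute.mul_left (ha.mul_right hb) (ha.mul_right hb)
    rw [h1, h3.mul_pow, mul_assoc, ← mul_assoc _ h a, ← h2.eq]
    simp only [mul_assoc]
  rw [alternatingProd_two_mul_add_one, alternatingProd_two_mul_add_one, fanGen_of_ne_zero hs,
    fanGen_of_ne_zero ht, key hcs hct, key hct hcs,
    mul_pow_mul_eq_of_involutive (fanReflection_mul_self s) (fanReflection_mul_self t) hpow]

/-! ### Relations of the fan Artin group -/

theorem Fin.val_one_of_one_le (hn : 1 ≤ n) : ((1 : Fin (n + 1)) : ℕ) = 1 := by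
  rw [Fin.val_one', Nat.mod_eq_of_lt (by omega)]

theorem Fin.one_ne_zero_of_one_le (hn : 1 ≤ n) : (1 : Fin (n + 1)) ≠ 0 := by
  rw [Ne, Fin.ext_iff, Fin.val_one_of_one_le hn, Fin.val_zero]
  exact one_ne_zero

theorem fanGraph_cases {s t : Fin (n + 1)} (hn : 1 ≤ n) (h : (fanGraph n).Adj s t) (hst : s < t) :
    s = 0 ∧ 1 ≤ (t : ℕ) ∨ s = 1 ∧ 2 ≤ (t : ℕ) := by
  have h1 := Fin.val_one_of_one_le hn
  have hlt : (s : ℕ) < t := hst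
  rw [fanGraph, SimpleGraph.fromRel_adj] at h
  simp only [Fin.ext_iff, Fin.val_zero, h1] at *
  omega

theorem fanLabel_of_lt {s t : Fin (n + 1)} (hst : s < t) :
    fanLabel n k l s(s, t) = if s = 0 then 2 * k t else 2 * l t + 1 := by
  simp [fanLabel, hst.le]

theorem alternatingProd_fanGen_of_adj (hn : 1 ≤ n) (hk : ∀ i ∈ Finset.Icc 1 n, 1 < k i)
    (hl : ∀ i ∈ Finset.Icc 2 n, 0 < l i) {s t : Fin (n + 1)} (h : (fanGraph n).Adj s t) :
    alternatingProd (fanGen k l s) (fanGen k l t) (fanLabel n k l s(s, t)) =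
      alternatingProd (fanGen k l t) (fanGen k l s) (fanLabel n k l s(s, t)) := by
  wlog hst : s < t generalizing s t
  · rw [Sym2.eq_swap]
    exact (this h.symm (lt_of_le_of_ne (not_lt.1 hst) h.ne')).symm
  have htn : (t : ℕ) ≤ n := Nat.lt_succ_iff.1 t.isLt
  rw [fanLabel_of_lt hst]
  rcases fanGraph_cases hn h hst with ⟨rfl, ht⟩ | ⟨rfl, ht⟩
  · rw [if_pos rfl]
    exact alternatingProd_fanGen_zero hst.ne' (hk _ (Finset.mem_Icc.2 ⟨ht, htn⟩))
  · have h1 := Fin.one_ne_zero_of_one_le hn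
    rw [if_neg h1]
    exact alternatingProd_fanGen h1 hst (hl _ (Finset.mem_Icc.2 ⟨ht, htn⟩))

/-- The action of the fan Artin group on `FanModule n`. -/
noncomputable def fanRep (hn : 1 ≤ n) (hk : ∀ i ∈ Finset.Icc 1 n, 1 < k i)
    (hl : ∀ i ∈ Finset.Icc 2 n, 0 < l i) :
    FanArtinGroup n k l →* (FanModule n ≃ₗ[ℝ[T;T⁻¹]] FanModule n) :=
  PresentedGroup.toGroup (f := fanGen k l) <| by
    rintro _ ⟨s, t, hst, rfl⟩
    rw [map_mul, map_inv, map_alternatingProd, map_alternatingProd, FreeGroup.lift_apply_of,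
      FreeGroup.lift_apply_of, alternatingProd_fanGen_of_adj hn hk hl hst, mul_inv_cancel]

theorem fanRep_fanVertex (hn : 1 ≤ n) (hk : ∀ i ∈ Finset.Icc 1 n, 1 < k i)
    (hl : ∀ i ∈ Finset.Icc 2 n, 0 < l i) (s : Fin (n + 1)) :
    fanRep hn hk hl (fanVertex n k l s) = fanGen k l s :=
  PresentedGroup.toGroup.of _

/-- The odd label on `u_1 — u_i` makes `u_i` and `u_1` conjugate, so `χ` agrees on them. -/
theorem RealCharacter.fanVertex_eq (hn : 1 ≤ n) (χ : RealCharacter (FanArtinGroup n k l))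
    {s : Fin (n + 1)} (hs : s ≠ 0) :
    χ (Additive.ofMul (fanVertex n k l s)) = χ (Additive.ofMul (fanVertex n k l 1)) := by
  rcases eq_or_ne s 1 with rfl | hs1
  · rfl
  have h1 := Fin.val_one_of_one_le hn
  have h10 := Fin.one_ne_zero_of_one_le hn
  have hlt : (1 : Fin (n + 1)) < s := by
    rw [Ne, Fin.ext_iff, h1] at hs1
    rw [Ne, Fin.ext_iff, Fin.val_zero] at hs
    rw [Fin.lt_def, h1]
    omega
  have hadj : (fanGraph n).Adj 1 s := by
    rw [fanGraph, SimpleGraph.fromRel_adj]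
    exact ⟨hs1.symm, Or.inl (Or.inr rfl)⟩
  have hrel : PresentedGroup.mk (artinRelators (fanGraph n) (fanLabel n k l)) _ = 1 :=
    PresentedGroup.one_of_mem ⟨1, s, hadj, rfl⟩
  rw [map_mul, map_inv, mul_inv_eq_one, map_alternatingProd, map_alternatingProd,
    fanLabel_of_lt hlt, if_neg h10, alternatingProd_two_mul_add_one,
    alternatingProd_two_mul_add_one] at hrel
  change (fanVertex n k l 1 * fanVertex n k l s) ^ l s * fanVertex n k l 1 =
    (fanVertex n k l s * fanVertex n k l 1) ^ l s * fanVertex n k l s at hrel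
  have := congrArg (fun g => χ (Additive.ofMul g)) hrel
  simp only [ofMul_mul, ofMul_pow, map_add, map_nsmul] at this
  rw [add_comm (χ (Additive.ofMul (fanVertex n k l s)))] at this
  exact (add_left_cancel this).symm

/-! ### The filtration by order in `T` -/

variable (n) in
/-- The vectors with last coordinate `0` in which no power of `T` below `T ^ r` occurs. -/
noncomputable def fanFiltration (r : ℝ) : AddSubgroup (FanModule n) where
  carrier := {w | w.2 = 0 ∧ ∀ (s : Fin (n + 1)) (j : ℤ), (j : ℝ) < r → (w.1 s).coeff j = 0}
  zero_mem' := ⟨rfl, fun _ _ _ => rfl⟩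
  add_mem' {v w} hv hw := ⟨by simp [hv.1, hw.1], fun s j hj => by
    simp [hv.2 s j hj, hw.2 s j hj]⟩
  neg_mem' {w} hw := ⟨by simp [hw.1], fun s j hj => by simp [hw.2 s j hj]⟩

theorem mem_fanFiltration {r : ℝ} {w : FanModule n} :
    w ∈ fanFiltration n r ↔
      w.2 = 0 ∧ ∀ (s : Fin (n + 1)) (j : ℤ), (j : ℝ) < r → (w.1 s).coeff j = 0 :=
  Iff.rfl

theorem fanFiltration_antitone : Antitone (fanFiltration n) := fun _ _ hab _ hw =>
  ⟨hw.1, fun s j hj => hw.2 s j (hj.trans_le hab)⟩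

theorem exists_mem_fanFiltration {w : FanModule n} (hw : w.2 = 0) :
    ∃ r, w ∈ fanFiltration n r := by
  have h (s : Fin (n + 1)) : ∃ b : ℤ, ∀ j < b, (w.1 s).coeff j = 0 := by
    obtain ⟨b, hb⟩ := (w.1 s).coeff.support.finite_toSet.bddBelow
    exact ⟨b, fun j hj => by_contra fun hne => hj.not_ge (hb (Finsupp.mem_support_iff.2 hne))⟩
  choose b hb using h
  obtain ⟨r, hr⟩ := (Set.finite_range b).bddBelow
  exact ⟨r, hw, fun s j hj => hb s j ((Int.cast_lt.1 hj).trans_le (hr ⟨s, rfl⟩))⟩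

theorem fanReflection_mem {s : Fin (n + 1)} {r : ℝ} {w : FanModule n}
    (hw : w ∈ fanFiltration n r) : fanReflection k l s w ∈ fanFiltration n r := by
  rw [fanReflection_apply]
  refine sub_mem hw ⟨by simp [fanRoot], fun t j hj => ?_⟩
  have hc : (fanCoroot n k l s w).coeff j = 0 := by
    rw [fanCoroot_apply, hw.1, ite_self, sub_zero, AddMonoidAlgebra.coeff_sum,
      Finset.sum_apply']
    refine Finset.sum_eq_zero fun t _ => ?_
    rw [← Algebra.smul_def, AddMonoidAlgebra.coeff_smul, Finsupp.smul_apply, hw.2 t j hj,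
      smul_zero]
  by_cases hts : t = s
  · subst hts
    simpa [fanRoot] using hc
  · simp [fanRoot, hts]

theorem fanReflection_mem_iff {s : Fin (n + 1)} {r : ℝ} {w : FanModule n} :
    fanReflection k l s w ∈ fanFiltration n r ↔ w ∈ fanFiltration n r := by
  refine ⟨fun h => ?_, fanReflection_mem⟩
  have := fanReflection_mem (k := k) (l := l) (s := s) h
  rwa [← LinearEquiv.mul_apply, fanReflection_mul_self] at this

theorem fanShift_mem_iff {r : ℝ} {w : FanModule n} :
    fanShift n w ∈ fanFiltration n (r + 1) ↔ w ∈ fanFiltration n r := by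
  have h (s : Fin (n + 1)) (j : ℤ) :
      ((fanShift n w).1 s).coeff j = (w.1 s).coeff (j - 1) := by
    change ((LaurentPolynomial.T 1 : ℝ[T;T⁻¹]) * w.1 s).coeff j = _
    rw [LaurentPolynomial.T, AddMonoidAlgebra.coeff_single_mul_apply, one_mul, neg_add_eq_sub]
  rw [mem_fanFiltration, mem_fanFiltration]
  simp only [h]
  refine and_congr_right fun _ => ⟨fun H s j hj => ?_, fun H s j hj => H s _ ?_⟩
  · simpa using H s (j + 1) (by push_cast; linarith)
  · push_cast; linarith

theorem fanGen_zero_mem_iff {r : ℝ} {w : FanModule n} :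
    fanGen k l 0 w ∈ fanFiltration n (r + 1) ↔ w ∈ fanFiltration n r := by
  rw [fanGen_zero, LinearEquiv.mul_apply, fanReflection_mem_iff, fanShift_mem_iff]

theorem fanGen_mem_iff {s : Fin (n + 1)} (hs : s ≠ 0) {r : ℝ} {w : FanModule n} :
    fanGen k l s w ∈ fanFiltration n (r + -1) ↔ w ∈ fanFiltration n r := by
  rw [fanGen_of_ne_zero hs, LinearEquiv.mul_apply, ← fanShift_mem_iff, ← LinearEquiv.mul_apply,
    mul_inv_cancel, neg_add_cancel_right, LinearEquiv.coe_one, id, fanReflection_mem_iff]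

section Rep

variable (hn : 1 ≤ n) (hk : ∀ i ∈ Finset.Icc 1 n, 1 < k i) (hl : ∀ i ∈ Finset.Icc 2 n, 0 < l i)

/-- An element `g` raises the order in `T` by exactly `χ g`. -/
theorem fanRep_mem_iff (χ : RealCharacter (FanArtinGroup n k l))
    (hu : χ (Additive.ofMul (fanVertex n k l 0)) = 1)
    (hu₁ : χ (Additive.ofMul (fanVertex n k l 1)) = -1) (g : FanArtinGroup n k l) :
    ∀ {r : ℝ} {w : FanModule n},
      fanRep hn hk hl g w ∈ fanFiltration n (r + χ (Additive.ofMul g)) ↔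
        w ∈ fanFiltration n r := by
  have hg : g ∈ Subgroup.closure (Set.range (fanVertex n k l)) := by
    rw [show fanVertex n k l = PresentedGroup.of from rfl, PresentedGroup.closure_range_of]
    trivial
  induction hg using Subgroup.closure_induction with
  | mem g hg =>
    obtain ⟨s, rfl⟩ := hg
    intro r w
    rw [fanRep_fanVertex]
    rcases eq_or_ne s 0 with rfl | hs
    · rw [hu, fanGen_zero_mem_iff]
    · rw [χ.fanVertex_eq hn hs, hu₁, fanGen_mem_iff hs]
  | one => simp
  | mul g g' _ _ h h' =>
    intro r w
    rw [ofMul_mul, map_add, map_mul, LinearEquiv.mul_apply, add_comm (χ _), ← add_assoc, h, h']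
  | inv g _ h =>
    intro r w
    rw [ofMul_inv, map_neg, ← h, neg_add_cancel_right, ← LinearEquiv.mul_apply, ← map_mul,
      mul_inv_cancel, map_one, LinearEquiv.coe_one, id]

theorem fanReflection_snd (s : Fin (n + 1)) (w : FanModule n) :
    (fanReflection k l s w).2 = w.2 := by
  simp [fanReflection_apply, fanRoot]

theorem fanRep_snd (g : FanArtinGroup n k l) :
    ∀ w : FanModule n, (fanRep hn hk hl g w).2 = w.2 := by
  have hg : g ∈ Subgroup.closure (Set.range (fanVertex n k l)) := by
    rw [show fanVertex n k l = PresentedGroup.of from rfl, PresentedGroup.closure_range_of]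
    trivial
  have hshift (w : FanModule n) : ((fanShift n)⁻¹ w).2 = w.2 := by
    conv_rhs => rw [← LinearEquiv.apply_symm_apply (fanShift n) w]
    rfl
  induction hg using Subgroup.closure_induction with
  | mem g hg =>
    obtain ⟨s, rfl⟩ := hg
    intro w
    rw [fanRep_fanVertex]
    rcases eq_or_ne s 0 with rfl | hs
    · rw [fanGen_zero, LinearEquiv.mul_apply, fanReflection_snd, fanShift_apply]
    · rw [fanGen_of_ne_zero hs, LinearEquiv.mul_apply, hshift, fanReflection_snd]
  | one => simp
  | mul g g' _ _ h h' => intro w; rw [map_mul, LinearEquiv.mul_apply, h, h']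
  | inv g _ h =>
    intro w
    rw [← h, ← LinearEquiv.mul_apply, ← map_mul, mul_inv_cancel, map_one, LinearEquiv.coe_one, id]

variable (n) in
/-- The basis vector of the last coordinate. -/
noncomputable def fanBase : FanModule n := (0, 1)

/-- The elements `u_1 ^ j (u u_1) u_1 ^ (-j)` of `ker χ` move the base vector by arbitrarily low
powers of `T`. -/
theorem not_exists_fanRep_sub_mem (χ : RealCharacter (FanArtinGroup n k l))
    (hu : χ (Additive.ofMul (fanVertex n k l 0)) = 1)
    (hu₁ : χ (Additive.ofMul (fanVertex n k l 1)) = -1) :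
    ¬ ∃ r, ∀ g, χ (Additive.ofMul g) = 0 →
      fanRep hn hk hl g (fanBase n) - fanBase n ∈ fanFiltration n r := by
  rintro ⟨r, hr⟩
  have h10 := Fin.one_ne_zero_of_one_le hn
  set u := fanVertex n k l 0
  set v := fanVertex n k l 1
  set ρ := fanRep hn hk hl
  obtain ⟨j, hj⟩ := exists_nat_gt (-r)
  have hsnd (s : Fin (n + 1)) : fanReflection k l s (fanBase n) =
      fanBase n + if s = 0 then fanRoot n 0 else 0 := by
    rw [fanReflection_apply, fanCoroot_apply]
    by_cases hs : s = 0
    · simp [hs, fanBase]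
    · simp [hs, fanBase]
  -- `u_1` fixes the base vector, and `u u_1` translates it by the root at `u`.
  have hv : ρ v (fanBase n) = fanBase n := by
    rw [fanRep_fanVertex, fanGen_of_ne_zero h10, LinearEquiv.mul_apply, hsnd, if_neg h10, add_zero]
    change (fanShift n).symm _ = _
    rw [LinearEquiv.symm_apply_eq, fanShift_apply]
    simp [fanBase]
  have hvj : ρ (v ^ j) (fanBase n) = fanBase n := by
    have (i : ℕ) : ρ (v ^ i) (fanBase n) = fanBase n := by
      induction i with
      | zero => simp
      | succ i ih => rw [pow_succ, map_mul, LinearEquiv.mul_apply, hv, ih]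
    exact this j
  have hvj' : ρ (v ^ j)⁻¹ (fanBase n) = fanBase n := by
    rw [map_inv]
    change (ρ (v ^ j)).symm _ = _
    rw [LinearEquiv.symm_apply_eq, hvj]
  have huv : ρ (u * v) (fanBase n) = fanBase n + fanRoot n 0 := by
    rw [map_mul, fanRep_fanVertex, fanRep_fanVertex, fanGen_zero_mul h10, LinearEquiv.mul_apply,
      hsnd, if_neg h10, add_zero, hsnd, if_pos rfl]
  have hχv : χ (Additive.ofMul (v ^ j)) = -j := by
    rw [ofMul_pow, map_nsmul, hu₁]
    simp
  have hχ : χ (Additive.ofMul (v ^ j * (u * v) * (v ^ j)⁻¹)) = 0 := by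
    rw [ofMul_mul, ofMul_mul, ofMul_mul, ofMul_inv, map_add, map_add, map_add, map_neg, hu, hu₁]
    ring
  have := hr _ hχ
  rw [map_mul, LinearEquiv.mul_apply, hvj', map_mul, LinearEquiv.mul_apply, huv, map_add, hvj,
    add_sub_cancel_left, ← sub_add_cancel r (-j : ℝ), ← hχv,
    fanRep_mem_iff hn hk hl χ hu hu₁] at this
  have := this.2 0 0 (by rw [hχv]; push_cast; linarith)
  simp [fanRoot] at this

end Rep

end Fan

open scoped LaurentPolynomial in
theorem propositionA (n : ℕ) (hn : 1 ≤ n) (k l : ℕ → ℕ)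
    (hk : ∀ i ∈ Finset.Icc 1 n, 1 < k i) (hl : ∀ i ∈ Finset.Icc 2 n, 0 < l i)
    (hsum : ∑ i ∈ Finset.Icc 2 n with (k i).isPowerOfTwo, (1 : ℚ) / (2 * (l i : ℚ) + 1) < 1)
    (χ : RealCharacter (FanArtinGroup n k l))
    (hu : χ (Additive.ofMul (fanVertex n k l 0)) = 1)
    (hu₁ : χ (Additive.ofMul (fanVertex n k l 1)) = -1) :
    rayOfNeZero ℝ χ (RealCharacter.ne_zero_of_eq_one hu) ∈ (sigmaOne (FanArtinGroup n k l))ᶜ ∧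
      ¬ χ.ker.FG := by
  let ψ : FanArtinGroup n k l →* AddMonoid.End (FanModule n) :=
    (DistribMulAction.toAddMonoidEnd (FanModule n ≃ₗ[ℝ[T;T⁻¹]] FanModule n) (FanModule n)).comp
      (fanRep hn hk hl)
  have hdir : Directed (· ≤ ·) (fanFiltration n) := fanFiltration_antitone.directed_le
  have hinv (g) (hg : 0 ≤ χ (Additive.ofMul g)) (r : ℝ) (w : FanModule n)
      (hw : w ∈ fanFiltration n r) : ψ g w ∈ fanFiltration n r :=
    fanFiltration_antitone (le_add_of_nonneg_right hg)
      ((fanRep_mem_iff hn hk hl χ hu hu₁ g).2 hw)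
  have hbase (g) : ∃ r, ψ g (fanBase n) - fanBase n ∈ fanFiltration n r :=
    exists_mem_fanFiltration (sub_eq_zero.2 (fanRep_snd hn hk hl g _))
  refine ⟨fun h => ?_, fun h => ?_⟩
  · have hFP := (rayOfNeZero_mem_sigmaInvariant _ 1).1 h
    obtain ⟨r, hr⟩ := hFP.exists_forall_sub_mem (ψ.comp (nonnegSubmonoid χ).subtype) (fanBase n)
      (fanFiltration n) hdir (fun g r w hw => hinv g g.2 r w hw) (fun g => hbase g)
    exact not_exists_fanRep_sub_mem hn hk hl χ hu hu₁ ⟨r, fun g hg => hr ⟨g, hg.ge⟩⟩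
  · have hFG : (AddSubgroup.toSubgroup' χ.ker).FG := (Subgroup.fg_iff_add_fg _).2 h
    obtain ⟨r, hr⟩ := hFG.exists_forall_sub_mem ψ (fanBase n) (fanFiltration n) hdir
      (fun g hg r w hw => hinv g (AddMonoidHom.mem_ker.1 hg).ge r w hw) (fun g _ => hbase g)
    exact not_exists_fanRep_sub_mem hn hk hl χ hu hu₁ ⟨r, fun g hg => hr g hg⟩
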